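/- Let $k\ge 2$. Write points of $\mathbb R^k$ as $x=(x',x'')$ with $x'\in\mathbb R$, $x''\in\mathbb R^{k-1}$. A compact set $\Gamma\subset\mathbb R^k$ is called a *Lipschitz curve* if there are constants $L,R>0$ such that for every $a\in\Gamma$ there exist an orthogonal transformation $U_a$ of $\mathbb R^k$ and a function $\varphi:(-R,R)\to\mathbb R^{k-1}$ with Lipschitz constant at most $L$ such that $$\{x:\ |x'|<R,\ |x''|<3LR\}\cap U_a(\Gamma-a)=\{(t,\varphi(t)):\ |t|<R\}.$$ Let $\eta(t)=t^{2-k}$ if $k>2$ and $\eta(t)=\log(1/t)$ if $k=2$, for $t>0$. **Theorem.** Let $\Omega\subset\mathbb R^k$ be a bounded open set, let $A\subset\Omega$ be a closed subset of a Lipschitz curve, and let $B\subset\mathbb R^k$ be a closed set with $B\cap\Omega\neq\emptyset$. Let $\beta>0$ and let $\psi:(\beta,\infty)\to(0,\infty)$ be a concave increasing function with $\psi(t)\to\infty$ as $t\to\infty$. Let $\alpha>0$ be so small that $\eta(t)>\beta$ for all $t\in(0,\alpha)$, and let $g=\psi\circ\eta$ on $(0,\alpha)$. Let $u:\Omega\setminus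 B\to[-\infty,\infty)$ be a subharmonic function such that $$u(x)\le g(\operatorname{dist}(x,A\cup B))\qquad\text{for all } x\in\Omega \text{ with } 0<\operatorname{dist}(x,A\cup B)<\alpha .$$ Then there exist constants $c_1,c_2,\tau>0$, with $c_1\tau\le\alpha$ and $c_2\tau\le\alpha$ (so that the right-hand side below is defined), such that $$u(x)\le 2g(c_1\operatorname{dist}(x,B))-g(c_2\operatorname{dist}(x,B))\qquad\text{for all } x\in\Omega \text{ with } 0<\operatorname{dist}(x,B)<\tau .$$ -/

import Mathlib

open scoped NNReal

/-- The component `x'` of `x = (x', x'')`: the first `p` of the `k = p + q` coordinates. -/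
def headPart {p q k : ℕ} (h : p + q = k) (x : EuclideanSpace ℝ (Fin k)) :
    EuclideanSpace ℝ (Fin p) :=
  WithLp.toLp 2 fun i => x (Fin.cast h (Fin.castAdd q i))

/-- The component `x''` of `x = (x', x'')`: the last `q` of the `k = p + q` coordinates. -/
def tailPart {p q k : ℕ} (h : p + q = k) (x : EuclideanSpace ℝ (Fin k)) :
    EuclideanSpace ℝ (Fin q) :=
  WithLp.toLp 2 fun i => x (Fin.cast h (Fin.natAdd p i))

/-- The open cylinder of radius `r` in the first `p` variables and radius `s` in the last `q`
variables, centred at `c`. -/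
def openCylinder {p q k : ℕ} (h : p + q = k) (c : EuclideanSpace ℝ (Fin k)) (r s : ℝ) :
    Set (EuclideanSpace ℝ (Fin k)) :=
  {x | headPart h x ∈ Metric.ball (headPart h c) r ∧ tailPart h x ∈ Metric.ball (tailPart h c) s}

/-- The graph, inside `ℝ^k = ℝ^p × ℝ^q`, of the restriction of `φ` to `V ⊆ ℝ^p`. -/
def graphOver {p q k : ℕ} (h : p + q = k) (φ : EuclideanSpace ℝ (Fin p) → EuclideanSpace ℝ (Fin q))
    (V : Set (EuclideanSpace ℝ (Fin p))) : Set (EuclideanSpace ℝ (Fin k)) :=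
  {x | headPart h x ∈ V ∧ tailPart h x = φ (headPart h x)}

/-- A compact set `A ⊆ ℝ^k` is a `p`-dimensional Lipschitz surface if, with uniform constants
`L, R > 0`, near each of its points it is, after a translation and an orthogonal transformation,
the graph over the ball of radius `R` in `ℝ^p` of a Lipschitz function with constant `≤ L`. -/
def IsLipschitzSurface {p q k : ℕ} (h : p + q = k) (A : Set (EuclideanSpace ℝ (Fin k))) : Prop :=
  IsCompact A ∧
    ∃ (L : ℝ≥0) (R : ℝ), 0 < L ∧ 0 < R ∧ ∀ a ∈ A,
      ∃ (φ : EuclideanSpace ℝ (Fin p) → EuclideanSpace ℝ (Fin q))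
        (U : EuclideanSpace ℝ (Fin k) ≃ₗᵢ[ℝ] EuclideanSpace ℝ (Fin k)),
        LipschitzOnWith L φ (Metric.ball 0 R) ∧
        openCylinder h 0 R (3 * L * R) ∩ (fun y => U (y - a)) '' A
          = graphOver h φ (Metric.ball 0 R)

/-- A Lipschitz curve is a `1`-dimensional Lipschitz surface. -/
def IsLipschitzCurve {k : ℕ} (A : Set (EuclideanSpace ℝ (Fin k))) : Prop :=
  ∃ (q : ℕ) (h : 1 + q = k), IsLipschitzSurface h A

/-- A function `u` with values in `[-∞, ∞)` is subharmonic on the open set `D` if it is upper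
semicontinuous there and, for each closed ball in `D`, it lies in that ball below every function
that is continuous on the closed ball, harmonic inside, and `≥ u` on the bounding sphere. -/
def IsSubharmonicOn {k : ℕ} (u : EuclideanSpace ℝ (Fin k) → EReal)
    (D : Set (EuclideanSpace ℝ (Fin k))) : Prop :=
  (∀ x ∈ D, u x < ⊤) ∧
  UpperSemicontinuousOn u D ∧
  ∀ (c : EuclideanSpace ℝ (Fin k)) (r : ℝ), 0 < r → Metric.closedBall c r ⊆ D →
    ∀ h : EuclideanSpace ℝ (Fin k) → ℝ,
      InnerProductSpace.HarmonicContOnCl h (Metric.ball c r) →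
      (∀ x ∈ Metric.sphere c r, u x ≤ ((h x : ℝ) : EReal)) →
      ∀ x ∈ Metric.ball c r, u x ≤ ((h x : ℝ) : EReal)

/-- The profile of the fundamental solution of the Laplace equation in `ℝ^k`, `k ≥ 2`:
`log (1/t)` if `k = 2` and `t^(2-k)` if `k > 2`. -/
noncomputable def fundProfile (k : ℕ) (t : ℝ) : ℝ :=
  if k = 2 then Real.log (1 / t) else t ^ (2 - (k : ℤ))

/-! Let `δ` be the distance from `x` to `B`, `r = δ/4`, `η = fundProfile k`, and let `d` be the
distance to `A ∪ B`. If `d x ≥ r`, the hypothesis at `x` suffices, `g` being decreasing. Otherwise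
the ball of radius `r` about `x` lies in `Ω \ B`, where `u` is subharmonic even across `A`. So `u x`
is at most a weighted mean over this ball of a majorant of `u`, and off `A` the function `ψ (η d)`
is one. By concavity (Jensen) the mean of `ψ (η d)` is at most `ψ` of the mean of `η d`.

The latter mean is controlled because `A` lies on a curve. The part of the ball at distance about `t
= r/2^j` from `A` has volume `O(2^j t^k)` (`IsLipschitzCurve.exists_volume_tube_le`), and `η` grows
by `O(t^(2-k))` from `t` to `t/2`. The products are `O(r² 2^(-j))` and can be summed, so the mean is
at most `η r + C r^(2-k) ≤ η (e^(-C) r)` (`IsLipschitzCurve.exists_weighted_mean_le`). Hence `u x ≤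
g (e^(-C) δ/4)` (`IsSubharmonicOn.le_of_le_comp_fundProfile`), which is more than is claimed.

Subharmonicity is defined by harmonic majorants, so the mean value inequality has to be derived
(`IsSubharmonicOn.weighted_mean_le`). By Stone–Weierstrass, polynomial boundary values suffice. For
these the Dirichlet problem on all concentric spheres is solved algebraically, by the bijectivity of
`q ↦ Δ(|x|² q)` on homogeneous polynomials. -/

open scoped NNReal
open MeasureTheory MvPolynomial

/-! ### Polynomials on `ℝ^k` and their Laplacian -/

/-- The Laplacian on polynomials. -/
noncomputable def polyLaplacian (k : ℕ) :
    MvPolynomial (Fin k) ℝ →ₗ[ℝ] MvPolynomial (Fin k) ℝ :=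
  ∑ i, (pderiv i).toLinearMap ∘ₗ (pderiv i).toLinearMap

/-- The polynomial `|x|²`. -/
noncomputable def normSqPoly (k : ℕ) : MvPolynomial (Fin k) ℝ := ∑ i, X i ^ 2

theorem polyLaplacian_apply {k : ℕ} (p : MvPolynomial (Fin k) ℝ) :
    polyLaplacian k p = ∑ i, pderiv i (pderiv i p) := by
  simp [polyLaplacian]

theorem eval_normSqPoly {k : ℕ} (x : EuclideanSpace ℝ (Fin k)) :
    eval x.ofLp (normSqPoly k) = ‖x‖ ^ 2 := by
  simp [normSqPoly, EuclideanSpace.real_norm_sq_eq]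

theorem continuous_eval_ofLp {k : ℕ} (p : MvPolynomial (Fin k) ℝ) :
    Continuous fun x : EuclideanSpace ℝ (Fin k) => eval x.ofLp p :=
  (MvPolynomial.continuous_eval p).comp (PiLp.continuous_ofLp 2 _)

theorem hasLineDerivAt_eval {k : ℕ} (p : MvPolynomial (Fin k) ℝ) (i : Fin k)
    (x : EuclideanSpace ℝ (Fin k)) :
    HasLineDerivAt ℝ (fun y : EuclideanSpace ℝ (Fin k) => eval y.ofLp p)
      (eval x.ofLp (pderiv i p)) x (EuclideanSpace.single i 1) := by
  unfold HasLineDerivAt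
  induction p using MvPolynomial.induction_on with
  | C a => simpa using hasDerivAt_const (0 : ℝ) a
  | add p q hp hq =>
    simp only [map_add]
    exact hp.add hq
  | mul_X p j hp =>
    have hj : HasDerivAt (fun t : ℝ => (x + t • EuclideanSpace.single i (1 : ℝ)).ofLp j)
        (if j = i then 1 else 0) 0 := by
      have := ((hasDerivAt_id (0 : ℝ)).mul_const (if j = i then (1 : ℝ) else 0)).const_add (x.ofLp j)
      simpa [Pi.single_apply] using this
    have := hp.mul hj
    simp only [zero_smul, add_zero] at this
    have he : eval x.ofLp (pderiv i (p * X j)) = eval x.ofLp (pderiv i p) * x.ofLp j +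
        eval x.ofLp p * (if j = i then 1 else 0) := by
      by_cases h : j = i
      · subst h; simp; ring
      · simp [pderiv_X_of_ne h, h]; ring
    rw [he]
    simp only [eval_mul, eval_X]
    exact this

theorem contDiff_eval {k : ℕ} (p : MvPolynomial (Fin k) ℝ) {n : WithTop ℕ∞} :
    ContDiff ℝ n fun x : EuclideanSpace ℝ (Fin k) => eval x.ofLp p := by
  induction p using MvPolynomial.induction_on with
  | C a => simpa using contDiff_const
  | add p q hp hq => simpa using hp.add hq
  | mul_X p j hp =>
    simp only [eval_mul, eval_X]
    exact hp.mul (by fun_prop)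

theorem fderiv_eval_single {k : ℕ} (p : MvPolynomial (Fin k) ℝ) (i : Fin k)
    (x : EuclideanSpace ℝ (Fin k)) :
    fderiv ℝ (fun y : EuclideanSpace ℝ (Fin k) => eval y.ofLp p) x (EuclideanSpace.single i 1)
      = eval x.ofLp (pderiv i p) := by
  have h := ((contDiff_eval p (n := 1)).differentiable (by norm_num) x).hasFDerivAt
  exact (h.hasLineDerivAt (EuclideanSpace.single i 1)).unique (hasLineDerivAt_eval p i x)

open InnerProductSpace Laplacian in
theorem laplacian_eval {k : ℕ} (p : MvPolynomial (Fin k) ℝ) (x : EuclideanSpace ℝ (Fin k)) :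
    (Δ (fun y : EuclideanSpace ℝ (Fin k) => eval y.ofLp p)) x
      = eval x.ofLp (polyLaplacian k p) := by
  rw [laplacian_eq_iteratedFDeriv_orthonormalBasis _ (EuclideanSpace.basisFun (Fin k) ℝ),
    polyLaplacian_apply, map_sum]
  refine Finset.sum_congr rfl fun i _ => ?_
  rw [iteratedFDeriv_two_apply]
  simp only [EuclideanSpace.basisFun_apply, Matrix.cons_val_zero, Matrix.cons_val_one]
  have hd : Differentiable ℝ (fderiv ℝ (fun y : EuclideanSpace ℝ (Fin k) => eval y.ofLp p)) :=
    ((contDiff_eval p (n := 2)).fderiv_right (m := 1) (by norm_num)).differentiable (by norm_num)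
  have := fderiv_clm_apply (hd x) (differentiableAt_const (EuclideanSpace.single i (1 : ℝ)))
  rw [← fderiv_eval_single (pderiv i p)]
  simp_rw [← fderiv_eval_single p i]
  rw [this]
  simp

open InnerProductSpace in
theorem harmonicContOnCl_eval_sub {k : ℕ} {p : MvPolynomial (Fin k) ℝ}
    (hp : polyLaplacian k p = 0) (c : EuclideanSpace ℝ (Fin k)) (s : Set (EuclideanSpace ℝ (Fin k))) :
    HarmonicContOnCl (fun y : EuclideanSpace ℝ (Fin k) => eval (y - c).ofLp p) s := by
  have key : (fun y : EuclideanSpace ℝ (Fin k) => eval (y - c).ofLp p)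
      = fun y => eval y.ofLp (bind₁ (fun i => X i - C (c.ofLp i)) p) := by
    funext y
    have := aeval_bind₁ (y.ofLp) (fun i => X i - C (c.ofLp i)) p
    simp only [aeval_eq_eval] at this
    rw [this]
    simp
    rfl
  -- A translation commutes with every `∂ᵢ`, hence with the Laplacian.
  have hl : polyLaplacian k (bind₁ (fun i => X i - C (c.ofLp i)) p)
      = bind₁ (fun i => X i - C (c.ofLp i)) (polyLaplacian k p) := by
    have h1 : ∀ (i : Fin k) (q : MvPolynomial (Fin k) ℝ),
        pderiv i (bind₁ (fun i => X i - C (c.ofLp i)) q)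
          = bind₁ (fun i => X i - C (c.ofLp i)) (pderiv i q) := by
      intro i q
      induction q using MvPolynomial.induction_on with
      | C a => simp
      | add p q hp hq => simp [hp, hq]
      | mul_X p j hp => simp [hp, pderiv_X, Pi.single_apply, apply_ite]
    simp [polyLaplacian_apply, h1, map_sum]
  refine ⟨fun y _ => ⟨?_, ?_⟩, ?_⟩
  · rw [key]; exact (contDiff_eval _).contDiffAt
  · refine Filter.Eventually.of_forall fun z => ?_
    rw [key, laplacian_eval, hl, hp]; simp
  · rw [key]; exact (continuous_eval_ofLp _).continuousOn

/-! ### Radial weights and orthogonality of harmonic polynomials -/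

theorem hasCompactSupport_mul_radial {k : ℕ} {w : ℝ → ℝ} {ρ : ℝ} (hw0 : ∀ s, ρ ≤ s → w s = 0)
    (f : EuclideanSpace ℝ (Fin k) → ℝ) :
    HasCompactSupport fun x => f x * w (‖x‖ ^ 2) := by
  refine HasCompactSupport.intro (isCompact_closedBall 0 (|ρ| + 1)) fun x hx => ?_
  have hx' : |ρ| + 1 < ‖x‖ := by simpa using hx
  rw [hw0, mul_zero]
  have := le_abs_self ρ
  have := abs_nonneg ρ
  nlinarith

theorem integrable_mul_radial {k : ℕ} {w : ℝ → ℝ} {ρ : ℝ} (hw : Continuous w)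
    (hw0 : ∀ s, ρ ≤ s → w s = 0) {f : EuclideanSpace ℝ (Fin k) → ℝ} (hf : Continuous f) :
    Integrable fun x => f x * w (‖x‖ ^ 2) :=
  (hf.mul (hw.comp (by fun_prop))).integrable_of_hasCompactSupport
    (hasCompactSupport_mul_radial hw0 f)

/-- A radial weight vanishing outside a ball has a primitive with the same property. -/
theorem exists_primitive_weight {w : ℝ → ℝ} {ρ : ℝ} (hw : Continuous w)
    (hw0 : ∀ s, ρ ≤ s → w s = 0) :
    ∃ W : ℝ → ℝ, (∀ s, HasDerivAt W (w s) s) ∧ ∀ s, ρ ≤ s → W s = 0 := by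
  refine ⟨fun s => ∫ t in ρ..s, w t, fun s => ?_, fun s hs => ?_⟩
  · exact intervalIntegral.integral_hasDerivAt_right (hw.intervalIntegrable _ _)
      hw.stronglyMeasurable.stronglyMeasurableAtFilter hw.continuousAt
  · beta_reduce
    rw [intervalIntegral.integral_congr (g := fun _ => (0 : ℝ))]
    · simp
    · intro t ht
      rw [Set.uIcc_of_le hs] at ht
      exact hw0 t ht.1

/-- Integration by parts: `xᵢ w(|x|²)` is the `i`-th derivative of `W(|x|²)/2`, which has compact
support. -/
theorem integral_X_mul_weight {k : ℕ} {w W : ℝ → ℝ} {ρ : ℝ} (hw : Continuous w)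
    (hw0 : ∀ s, ρ ≤ s → w s = 0) (hW : ∀ s, HasDerivAt W (w s) s) (hW0 : ∀ s, ρ ≤ s → W s = 0)
    (p : MvPolynomial (Fin k) ℝ) (i : Fin k) :
    ∫ x : EuclideanSpace ℝ (Fin k), eval x.ofLp (X i * p) * w (‖x‖ ^ 2)
      = - ∫ x : EuclideanSpace ℝ (Fin k), eval x.ofLp (pderiv i p) * (W (‖x‖ ^ 2) / 2) := by
  have hWc : Continuous W := continuous_iff_continuousAt.2 fun s => (hW s).continuousAt
  have hder : ∀ x : EuclideanSpace ℝ (Fin k),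
      HasFDerivAt (fun y : EuclideanSpace ℝ (Fin k) => W (‖y‖ ^ 2) / 2)
        ((w (‖x‖ ^ 2)) • (innerSL ℝ x)) x := by
    intro x
    have h1 := ((hW (‖x‖ ^ 2)).comp_hasFDerivAt x (hasStrictFDerivAt_norm_sq x).hasFDerivAt)
    refine ((h1.const_mul (1 / 2 : ℝ)).congr_fderiv ?_).congr_of_eventuallyEq
      (Filter.Eventually.of_forall fun y => ?_)
    · ext y; simp; ring
    · simp; ring
  have hf : ∀ x : EuclideanSpace ℝ (Fin k),
      fderiv ℝ (fun y : EuclideanSpace ℝ (Fin k) => W (‖y‖ ^ 2) / 2) x (EuclideanSpace.single i 1)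
        = w (‖x‖ ^ 2) * x.ofLp i := by
    intro x
    rw [(hder x).fderiv]
    simp [EuclideanSpace.inner_single_right]
  have hW2 : ∀ s, ρ ≤ s → (fun s => W s / 2) s = 0 := fun s hs => by simp [hW0 s hs]
  have hW2c : Continuous fun s => W s / 2 := hWc.div_const 2
  have key := integral_mul_fderiv_eq_neg_fderiv_mul_of_integrable
    (μ := (volume : Measure (EuclideanSpace ℝ (Fin k))))
    (f := fun y : EuclideanSpace ℝ (Fin k) => eval y.ofLp p)
    (g := fun y : EuclideanSpace ℝ (Fin k) => W (‖y‖ ^ 2) / 2)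
    (v := EuclideanSpace.single i 1) ?_ ?_ ?_
    (fun x _ => (contDiff_eval p (n := 1)).differentiable (by norm_num) x)
    (fun x _ => (hder x).differentiableAt)
  · simp only [hf, fderiv_eval_single] at key
    rw [← key]
    congr 1; funext x; simp; ring
  · simp only [fderiv_eval_single]
    exact integrable_mul_radial hW2c hW2 (continuous_eval_ofLp _)
  · simp only [hf]
    refine (integrable_mul_radial hw hw0 (continuous_eval_ofLp (X i * p))).congr ?_
    refine Filter.Eventually.of_forall fun x => ?_
    simp; ring
  · exact integrable_mul_radial hW2c hW2 (continuous_eval_ofLp _)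

/-- Green's identity for two homogeneous polynomials, the first of them harmonic, on a ball with
a radial weight. -/
theorem integral_harmonic_mul_weight {k : ℕ} {w W : ℝ → ℝ} {ρ : ℝ} (hw : Continuous w)
    (hw0 : ∀ s, ρ ≤ s → w s = 0) (hW : ∀ s, HasDerivAt W (w s) s) (hW0 : ∀ s, ρ ≤ s → W s = 0)
    {v g : MvPolynomial (Fin k) ℝ} {d e : ℕ} (hv : v.IsHomogeneous d) (hg : g.IsHomogeneous e)
    (hvl : polyLaplacian k v = 0) :
    ((d : ℝ) - e) * ∫ x : EuclideanSpace ℝ (Fin k), eval x.ofLp (v * g) * w (‖x‖ ^ 2)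
      = ∫ x : EuclideanSpace ℝ (Fin k),
          eval x.ofLp (v * polyLaplacian k g) * (W (‖x‖ ^ 2) / 2) := by
  have hWc : Continuous W := continuous_iff_continuousAt.2 fun s => (hW s).continuousAt
  have hW2 : ∀ s, ρ ≤ s → (fun s => W s / 2) s = 0 := fun s hs => by simp [hW0 s hs]
  have hW2c : Continuous fun s => W s / 2 := hWc.div_const 2
  -- The field `g ∇v - v ∇g` has radial part `(d - e) v g` by Euler's identity and divergence `-v
  -- Δg`.
  have hsum := Finset.sum_congr (rfl : (Finset.univ : Finset (Fin k)) = Finset.univ)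
    fun i _ => integral_X_mul_weight hw hw0 hW hW0 (g * pderiv i v - v * pderiv i g) i
  rw [Finset.sum_neg_distrib, ← integral_finsetSum _ fun i _ => integrable_mul_radial hw hw0
      (continuous_eval_ofLp _), ← integral_finsetSum _ fun i _ => integrable_mul_radial hW2c hW2
      (continuous_eval_ofLp _)] at hsum
  simp only [← Finset.sum_mul, ← map_sum] at hsum
  have h1 : ∑ i, X i * (g * pderiv i v - v * pderiv i g) = C ((d : ℝ) - e) * (v * g) := by
    have hd := hv.sum_X_mul_pderiv
    have he := hg.sum_X_mul_pderiv
    calc ∑ i, X i * (g * pderiv i v - v * pderiv i g)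
        = g * ∑ i, X i * pderiv i v - v * ∑ i, X i * pderiv i g := by
          rw [Finset.mul_sum, Finset.mul_sum, ← Finset.sum_sub_distrib]
          exact Finset.sum_congr rfl fun i _ => by ring
      _ = C ((d : ℝ) - e) * (v * g) := by
          rw [hd, he]; simp; ring
  have h2 : ∑ i, pderiv i (g * pderiv i v - v * pderiv i g) = -(v * polyLaplacian k g) := by
    have : ∑ i, pderiv i (g * pderiv i v - v * pderiv i g)
        = g * polyLaplacian k v - v * polyLaplacian k g := by
      rw [polyLaplacian_apply, polyLaplacian_apply, Finset.mul_sum, Finset.mul_sum,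
        ← Finset.sum_sub_distrib]
      refine Finset.sum_congr rfl fun i _ => ?_
      simp only [map_sub, pderiv_mul]; ring
    rw [this, hvl]; ring
  rw [h1, h2] at hsum
  simp only [map_mul, map_neg, eval_C, neg_mul, integral_neg, neg_neg, mul_assoc,
    integral_const_mul] at hsum
  simpa only [map_mul, mul_assoc] using hsum

theorem isHomogeneous_polyLaplacian {k n : ℕ} {p : MvPolynomial (Fin k) ℝ}
    (hp : p.IsHomogeneous n) : (polyLaplacian k p).IsHomogeneous (n - 2) := by
  rw [polyLaplacian_apply]
  exact IsHomogeneous.sum _ _ _ fun i _ => hp.pderiv.pderiv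

theorem polyLaplacian_eq_zero_of_lt_two {k n : ℕ} {p : MvPolynomial (Fin k) ℝ}
    (hp : p.IsHomogeneous n) (hn : n < 2) : polyLaplacian k p = 0 := by
  rw [polyLaplacian_apply]
  refine Finset.sum_eq_zero fun i _ => ?_
  have h0 : (pderiv i p).IsHomogeneous 0 := by
    have := hp.pderiv (i := i)
    rwa [show n - 1 = 0 by omega] at this
  rw [← totalDegree_zero_iff_isHomogeneous, totalDegree_eq_zero_iff_eq_C] at h0
  rw [h0, pderiv_C]

/-- A homogeneous harmonic polynomial is orthogonal to all homogeneous polynomials of lower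
degree, for every radial weight. -/
theorem integral_harmonic_mul_eq_zero {k : ℕ} {ρ : ℝ} {v : MvPolynomial (Fin k) ℝ} {d : ℕ}
    (hv : v.IsHomogeneous d) (hvl : polyLaplacian k v = 0) (e : ℕ) (hed : e < d)
    (g : MvPolynomial (Fin k) ℝ) (hg : g.IsHomogeneous e) (w : ℝ → ℝ) (hw : Continuous w)
    (hw0 : ∀ s, ρ ≤ s → w s = 0) :
    ∫ x : EuclideanSpace ℝ (Fin k), eval x.ofLp (v * g) * w (‖x‖ ^ 2) = 0 := by
  induction e using Nat.strong_induction_on generalizing g w with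
  | _ e ih =>
    -- Green's identity lowers `e` by 2 and replaces `w` by half its primitive, so the induction
    -- runs over all weights; it stops when `e < 2`, where `Δg = 0`.
    obtain ⟨W, hW, hW0⟩ := exists_primitive_weight hw hw0
    have key := integral_harmonic_mul_weight hw hw0 hW hW0 hv hg hvl
    have hne : (d : ℝ) - e ≠ 0 := sub_ne_zero.2 (by exact_mod_cast hed.ne')
    refine (mul_eq_zero.1 (key.trans ?_)).resolve_left hne
    by_cases he : e < 2
    · rw [polyLaplacian_eq_zero_of_lt_two hg he]; simp
    · have hWc : Continuous W := continuous_iff_continuousAt.2 fun s => (hW s).continuousAt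
      exact ih (e - 2) (by omega) (by omega) _ (isHomogeneous_polyLaplacian hg) (fun s => W s / 2)
        (hWc.div_const 2) fun s hs => by simp [hW0 s hs]

/-! ### The Dirichlet problem with polynomial data -/

theorem normSqPoly_isHomogeneous (k : ℕ) : (normSqPoly k).IsHomogeneous 2 :=
  IsHomogeneous.sum _ _ _ fun i _ => by simpa using (isHomogeneous_X ℝ i).pow 2

theorem normSqPoly_ne_zero {k : ℕ} (hk : 0 < k) : normSqPoly k ≠ 0 := by
  intro h
  have := eval_normSqPoly (EuclideanSpace.single (⟨0, hk⟩ : Fin k) (1 : ℝ))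
  simp [h] at this

/-- If `|x|² q` is harmonic, it is orthogonal to `q`, which has lower degree; thus `∫ |x|² q² w = 0`
with a nonnegative integrand. -/
theorem eq_zero_of_polyLaplacian_normSqPoly_mul {k n : ℕ} (hk : 0 < k)
    {q : MvPolynomial (Fin k) ℝ} (hq : q.IsHomogeneous n)
    (h : polyLaplacian k (normSqPoly k * q) = 0) : q = 0 := by
  suffices hz : normSqPoly k * q = 0 from
    (mul_eq_zero.1 hz).resolve_left (normSqPoly_ne_zero hk)
  refine MvPolynomial.funext fun y => ?_
  set x₀ : EuclideanSpace ℝ (Fin k) := WithLp.toLp 2 y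
  change eval x₀.ofLp (normSqPoly k * q) = eval x₀.ofLp 0
  by_contra hne
  -- This makes the weight equal to 1 at `x₀`.
  set ρ := ‖x₀‖ ^ 2 + 1
  have hw : Continuous fun s : ℝ => max (ρ - s) 0 := by fun_prop
  have hw0 : ∀ s, ρ ≤ s → max (ρ - s) 0 = 0 := fun s hs => max_eq_right (by linarith)
  have hint := integral_harmonic_mul_eq_zero ((normSqPoly_isHomogeneous k).mul hq) h n (by omega)
    q hq _ hw hw0
  refine (Continuous.integral_pos_of_hasCompactSupport_nonneg_nonzero
    (μ := (volume : Measure (EuclideanSpace ℝ (Fin k)))) (x := x₀)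
    ((continuous_eval_ofLp (normSqPoly k * q * q)).mul (hw.comp (by fun_prop)))
    (hasCompactSupport_mul_radial hw0 _) (fun x => ?_) ?_).ne' hint
  · change 0 ≤ eval x.ofLp (normSqPoly k * q * q) * max (ρ - ‖x‖ ^ 2) 0
    simp only [map_mul, eval_normSqPoly]
    have : 0 ≤ max (ρ - ‖x‖ ^ 2) 0 := le_max_right _ _
    have h2 : 0 ≤ ‖x‖ ^ 2 * (eval x.ofLp q * eval x.ofLp q) :=
      mul_nonneg (sq_nonneg _) (mul_self_nonneg _)
    rw [← mul_assoc] at h2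
    positivity
  · simp only [map_mul, map_zero, mul_eq_zero, not_or] at hne ⊢
    simp [ρ, hne.1, hne.2]

theorem finite_homogeneousSubmodule (k n : ℕ) :
    Module.Finite ℝ (homogeneousSubmodule (Fin k) ℝ n) :=
  Submodule.finiteDimensional_of_le (S₂ := restrictTotalDegree (Fin k) ℝ n) fun p hp => by
    rw [mem_restrictTotalDegree]
    exact IsHomogeneous.totalDegree_le hp

/-- An injective endomorphism of a finite-dimensional space is surjective. -/
theorem exists_polyLaplacian_normSqPoly_mul {k n : ℕ} (hk : 0 < k) {p : MvPolynomial (Fin k) ℝ}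
    (hp : p.IsHomogeneous n) :
    ∃ q : MvPolynomial (Fin k) ℝ, q.IsHomogeneous n ∧ polyLaplacian k (normSqPoly k * q) = p := by
  have := finite_homogeneousSubmodule k n
  let T : homogeneousSubmodule (Fin k) ℝ n →ₗ[ℝ] homogeneousSubmodule (Fin k) ℝ n :=
    LinearMap.restrict (polyLaplacian k ∘ₗ LinearMap.mulLeft ℝ (normSqPoly k)) fun q hq => by
      have := isHomogeneous_polyLaplacian ((normSqPoly_isHomogeneous k).mul hq)
      rwa [show 2 + n - 2 = n by omega] at this
  have hT : Function.Injective T := by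
    rw [← LinearMap.ker_eq_bot, LinearMap.ker_eq_bot']
    intro q hq
    exact Subtype.ext (eq_zero_of_polyLaplacian_normSqPoly_mul hk q.2 (congrArg Subtype.val hq))
  obtain ⟨q, hq⟩ := LinearMap.injective_iff_surjective.1 hT ⟨p, hp⟩
  exact ⟨q, q.2, congrArg Subtype.val hq⟩

/-- For every polynomial `p` there are harmonic polynomials `H s` such that `H s` agrees with `p`
on the sphere `|x|² = s`; integrals of `p` against radial weights only see the values `H s` at the
centre. -/
theorem exists_harmonic_family {k : ℕ} (hk : 0 < k) (p : MvPolynomial (Fin k) ℝ) :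
    ∃ H : ℝ → MvPolynomial (Fin k) ℝ, (∀ s, polyLaplacian k (H s) = 0) ∧
      (∀ x : EuclideanSpace ℝ (Fin k), eval x.ofLp (H (‖x‖ ^ 2)) = eval x.ofLp p) ∧
      (Continuous fun s => eval 0 (H s)) ∧
      ∀ (w : ℝ → ℝ) (ρ : ℝ), Continuous w → (∀ s, ρ ≤ s → w s = 0) →
        ∫ x : EuclideanSpace ℝ (Fin k), eval x.ofLp p * w (‖x‖ ^ 2)
          = ∫ x : EuclideanSpace ℝ (Fin k), eval 0 (H (‖x‖ ^ 2)) * w (‖x‖ ^ 2) := by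
  have hom : ∀ (n : ℕ) (p : MvPolynomial (Fin k) ℝ), p.IsHomogeneous n →
      ∃ H : ℝ → MvPolynomial (Fin k) ℝ, (∀ s, polyLaplacian k (H s) = 0) ∧
      (∀ x : EuclideanSpace ℝ (Fin k), eval x.ofLp (H (‖x‖ ^ 2)) = eval x.ofLp p) ∧
      (Continuous fun s => eval 0 (H s)) ∧
      ∀ (w : ℝ → ℝ) (ρ : ℝ), Continuous w → (∀ s, ρ ≤ s → w s = 0) →
        ∫ x : EuclideanSpace ℝ (Fin k), eval x.ofLp p * w (‖x‖ ^ 2)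
          = ∫ x : EuclideanSpace ℝ (Fin k), eval 0 (H (‖x‖ ^ 2)) * w (‖x‖ ^ 2) := by
    intro n
    induction n using Nat.strong_induction_on with
    | _ n ih =>
      -- In degree 0 the polynomial is constant; in positive degree it vanishes at 0 and is
      -- orthogonal to 1.
      have harm : ∀ p : MvPolynomial (Fin k) ℝ, p.IsHomogeneous n → polyLaplacian k p = 0 →
          ∀ (w : ℝ → ℝ) (ρ : ℝ), Continuous w → (∀ s, ρ ≤ s → w s = 0) →
          ∫ x : EuclideanSpace ℝ (Fin k), eval x.ofLp p * w (‖x‖ ^ 2)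
            = ∫ x : EuclideanSpace ℝ (Fin k), eval 0 p * w (‖x‖ ^ 2) := by
        intro p hp hpl w ρ hw hw0
        rcases Nat.eq_zero_or_pos n with rfl | hn
        · rw [← totalDegree_zero_iff_isHomogeneous, totalDegree_eq_zero_iff_eq_C] at hp
          rw [hp]; simp
        · have h1 := integral_harmonic_mul_eq_zero hp hpl 0 hn 1 (isHomogeneous_one _ _) w hw hw0
          have h2 : eval (0 : Fin k → ℝ) p = 0 := by
            rw [MvPolynomial.eval_zero, constantCoeff_eq]
            exact hp.coeff_eq_zero (by simpa using hn.ne)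
          rw [h2]
          simpa using h1
      intro p hp
      by_cases hn : n < 2
      · have hpl := polyLaplacian_eq_zero_of_lt_two hp hn
        exact ⟨fun _ => p, fun _ => hpl, fun _ => rfl, continuous_const, harm p hp hpl⟩
      · obtain ⟨q, hq, hql⟩ :=
          exists_polyLaplacian_normSqPoly_mul hk (isHomogeneous_polyLaplacian hp)
        obtain ⟨H, hH, hHx, hHc, hHw⟩ := ih (n - 2) (by omega) q hq
        have hhl : polyLaplacian k (p - normSqPoly k * q) = 0 := by rw [map_sub, hql, sub_self]
        have hh : (p - normSqPoly k * q).IsHomogeneous n := by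
          have := (normSqPoly_isHomogeneous k).mul hq
          rw [show 2 + (n - 2) = n by omega] at this
          exact hp.sub this
        -- `p - |x|² q` is harmonic, and on the sphere `|x|² = s` the other summand is `s q`, with
        -- `q` of degree `n - 2`. In the integral formula the factor `s` is absorbed into the
        -- weight.
        refine ⟨fun s => (p - normSqPoly k * q) + s • H s, fun s => ?_, fun x => ?_, ?_, ?_⟩
        · rw [map_add, map_smul, hhl, hH]; simp
        · simp [hHx, eval_normSqPoly]
        · simp only [map_add, smul_eval]
          exact continuous_const.add (continuous_id.mul hHc)
        · intro w ρ hw hw0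
          have hsw : Continuous fun s => s * w s := continuous_id.mul hw
          have hsw0 : ∀ s, ρ ≤ s → s * w s = 0 := fun s hs => by rw [hw0 s hs, mul_zero]
          have hc : Continuous fun x : EuclideanSpace ℝ (Fin k) => eval 0 (H (‖x‖ ^ 2)) :=
            hHc.comp (by fun_prop)
          have e1 : ∀ x : EuclideanSpace ℝ (Fin k), eval x.ofLp p * w (‖x‖ ^ 2)
              = eval x.ofLp (p - normSqPoly k * q) * w (‖x‖ ^ 2)
                + eval x.ofLp q * (‖x‖ ^ 2 * w (‖x‖ ^ 2)) := by
            intro x; simp [eval_normSqPoly]; ring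
          have e2 : ∀ x : EuclideanSpace ℝ (Fin k),
              eval 0 ((p - normSqPoly k * q) + ‖x‖ ^ 2 • H (‖x‖ ^ 2)) * w (‖x‖ ^ 2)
              = eval 0 (p - normSqPoly k * q) * w (‖x‖ ^ 2)
                + eval 0 (H (‖x‖ ^ 2)) * (‖x‖ ^ 2 * w (‖x‖ ^ 2)) := by
            intro x; simp only [map_add, smul_eval]; ring
          simp_rw [e1, e2]
          rw [integral_add (integrable_mul_radial hw hw0 (continuous_eval_ofLp _))
              (integrable_mul_radial hsw hsw0 (continuous_eval_ofLp _)),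
            integral_add (integrable_mul_radial hw hw0 continuous_const)
              (integrable_mul_radial hsw hsw0 hc), harm _ hh hhl w ρ hw hw0,
            hHw (fun s => s * w s) ρ hsw hsw0]
  choose! F hF using hom
  refine ⟨fun s => ∑ i ∈ Finset.range (p.totalDegree + 1), F i (homogeneousComponent i p) s,
    fun s => ?_, fun x => ?_, ?_, fun w ρ hw hw0 => ?_⟩
  · rw [map_sum]
    exact Finset.sum_eq_zero fun i _ => (hF i _ (homogeneousComponent_isHomogeneous i p)).1 s
  · conv_rhs => rw [← sum_homogeneousComponent p]
    rw [map_sum, map_sum]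
    exact Finset.sum_congr rfl fun i _ => (hF i _ (homogeneousComponent_isHomogeneous i p)).2.1 x
  · simp only [map_sum]
    exact continuous_finsetSum _ fun i _ =>
      (hF i _ (homogeneousComponent_isHomogeneous i p)).2.2.1
  · conv_lhs => rw [← sum_homogeneousComponent p]
    simp only [map_sum, Finset.sum_mul]
    have hc : ∀ i, Continuous fun x : EuclideanSpace ℝ (Fin k) =>
        eval 0 (F i (homogeneousComponent i p) (‖x‖ ^ 2)) := fun i =>
      (hF i _ (homogeneousComponent_isHomogeneous i p)).2.2.1.comp (by fun_prop)
    rw [integral_finsetSum _ fun i _ => integrable_mul_radial hw hw0 (continuous_eval_ofLp _),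
      integral_finsetSum _ fun i _ => integrable_mul_radial hw hw0 (hc i)]
    exact Finset.sum_congr rfl fun i _ =>
      (hF i _ (homogeneousComponent_isHomogeneous i p)).2.2.2 w ρ hw hw0

/-! ### The mean value inequality for subharmonic functions -/

theorem exists_polynomial_near {k : ℕ} {F : EuclideanSpace ℝ (Fin k) → ℝ} (hF : Continuous F)
    {K : Set (EuclideanSpace ℝ (Fin k))} (hK : IsCompact K) {ε : ℝ} (hε : 0 < ε) :
    ∃ p : MvPolynomial (Fin k) ℝ, ∀ x ∈ K, |eval x.ofLp p - F x| < ε := by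
  let coord : Fin k → C(EuclideanSpace ℝ (Fin k), ℝ) := fun i => ⟨fun x => x.ofLp i, by fun_prop⟩
  have hev : ∀ (p : MvPolynomial (Fin k) ℝ) (x : EuclideanSpace ℝ (Fin k)),
      aeval coord p x = eval x.ofLp p := by
    intro p x
    induction p using MvPolynomial.induction_on with
    | C a => simp
    | add p q hp hq => simp [hp, hq]
    | mul_X p i hp => simp [hp, coord]
  have hsep : (aeval (R := ℝ) coord).range.SeparatesPoints := by
    intro x y hxy
    obtain ⟨i, hi⟩ : ∃ i, x.ofLp i ≠ y.ofLp i := by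
      by_contra! h
      exact hxy (by ext i; exact h i)
    exact ⟨_, ⟨coord i, ⟨X i, by simp⟩, rfl⟩, hi⟩
  obtain ⟨g, ⟨p, rfl⟩, hg⟩ :=
    ContinuousMap.exists_mem_subalgebra_near_continuous_of_isCompact_of_separatesPoints hsep
      ⟨F, hF⟩ hK hε
  refine ⟨p, fun x hx => ?_⟩
  have := hg x hx
  rw [← hev]
  exact this

/-- The value of a subharmonic function at the centre of a ball is at most the weighted mean over
the ball of any continuous majorant. -/
theorem IsSubharmonicOn.weighted_mean_le {k : ℕ} (hk : 0 < k)
    {u : EuclideanSpace ℝ (Fin k) → EReal} {D : Set (EuclideanSpace ℝ (Fin k))}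
    (hu : IsSubharmonicOn u D) {c : EuclideanSpace ℝ (Fin k)} {r : ℝ}
    (hball : Metric.closedBall c r ⊆ D) {F : EuclideanSpace ℝ (Fin k) → ℝ} (hF : Continuous F)
    (huF : ∀ y ∈ Metric.closedBall c r, u y ≤ (F y : EReal)) {m : ℝ} (hm : (m : EReal) ≤ u c)
    {w : ℝ → ℝ} (hw : Continuous w) (hw0 : ∀ s, r ^ 2 ≤ s → w s = 0) (hwn : ∀ s, 0 ≤ w s)
    (hr : 0 < r) :
    m * ∫ x : EuclideanSpace ℝ (Fin k), w (‖x‖ ^ 2)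
      ≤ ∫ x : EuclideanSpace ℝ (Fin k), F (c + x) * w (‖x‖ ^ 2) := by
  set I := ∫ x : EuclideanSpace ℝ (Fin k), w (‖x‖ ^ 2) with hI
  have hI0 : 0 ≤ I := integral_nonneg fun x => hwn _
  have hFc : Continuous fun x => F (c + x) := hF.comp (by fun_prop)
  refine le_of_forall_pos_le_add fun δ hδ => ?_
  set ε := δ / (2 * (I + 1)) with hεdef
  have hε : 0 < ε := by positivity
  have hεI : 2 * ε * I ≤ δ := by
    rw [hεdef]
    have : 2 * (δ / (2 * (I + 1))) * I = δ * (I / (I + 1)) := by field_simp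
    rw [this]
    have : I / (I + 1) ≤ 1 := (div_le_one (by linarith)).2 (by linarith)
    nlinarith
  obtain ⟨p₀, hp₀⟩ := exists_polynomial_near hFc (isCompact_closedBall 0 r) hε
  -- The shift by `ε` gives `F ≤ p ≤ F + 2ε` on the ball.
  set p := p₀ + C ε with hp
  have hpl : ∀ x : EuclideanSpace ℝ (Fin k), ‖x‖ ≤ r → F (c + x) ≤ eval x.ofLp p := by
    intro x hx
    have := abs_lt.1 (hp₀ x (by simpa using hx))
    simp only [hp, map_add, eval_C]; linarith
  have hpu : ∀ x : EuclideanSpace ℝ (Fin k), ‖x‖ ≤ r → eval x.ofLp p ≤ F (c + x) + 2 * ε := by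
    intro x hx
    have := abs_lt.1 (hp₀ x (by simpa using hx))
    simp only [hp, map_add, eval_C]; linarith
  obtain ⟨H, hH, hHx, hHc, hHw⟩ := exists_harmonic_family hk p
  -- `H (‖x‖ ^ 2)` is a harmonic majorant for the ball of radius `‖x‖`, taken at its centre. At `x =
  -- 0` there is no ball, and `F ≤ p` is used directly.
  have hval : ∀ x : EuclideanSpace ℝ (Fin k), ‖x‖ ≤ r → m ≤ eval 0 (H (‖x‖ ^ 2)) := by
    intro x hx
    rcases eq_or_ne x 0 with rfl | hx0
    · have h0 : m ≤ F c := by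
        have := hm.trans (huF c (Metric.mem_closedBall_self hr.le))
        exact_mod_cast this
      have h1 := hpl 0 (by simpa using hr.le)
      rw [← hHx 0] at h1
      simp only [add_zero] at h1
      exact h0.trans h1
    · have hx' : 0 < ‖x‖ := norm_pos_iff.2 hx0
      have := hu.2.2 c ‖x‖ hx' ((Metric.closedBall_subset_closedBall hx).trans hball)
        (fun y => eval (y - c).ofLp (H (‖x‖ ^ 2))) (harmonicContOnCl_eval_sub (hH _) c _)
        (fun y hy => ?_) c (Metric.mem_ball_self hx')
      · have h2 := hm.trans this
        simp only [sub_self] at h2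
        exact_mod_cast h2
      · have hyn : ‖y - c‖ = ‖x‖ := by simpa [dist_eq_norm] using hy
        refine (huF y ?_).trans ?_
        · rw [mem_closedBall_iff_norm, hyn]; exact hx
        · have h3 := hpl (y - c) (hyn.le.trans hx)
          rw [← hHx, hyn, add_sub_cancel] at h3
          exact_mod_cast h3
  have hout : ∀ x : EuclideanSpace ℝ (Fin k), ¬ ‖x‖ ≤ r → w (‖x‖ ^ 2) = 0 := fun x hx =>
    hw0 _ (by nlinarith)
  have hHcc : Continuous fun x : EuclideanSpace ℝ (Fin k) => eval 0 (H (‖x‖ ^ 2)) :=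
    hHc.comp (by fun_prop)
  calc m * I = ∫ x : EuclideanSpace ℝ (Fin k), m * w (‖x‖ ^ 2) := by rw [integral_const_mul]
    _ ≤ ∫ x : EuclideanSpace ℝ (Fin k), eval 0 (H (‖x‖ ^ 2)) * w (‖x‖ ^ 2) := by
        refine integral_mono (integrable_mul_radial hw hw0 continuous_const)
          (integrable_mul_radial hw hw0 hHcc) fun x => ?_
        by_cases hx : ‖x‖ ≤ r
        · exact mul_le_mul_of_nonneg_right (hval x hx) (hwn _)
        · simp [hout x hx]
    _ = ∫ x : EuclideanSpace ℝ (Fin k), eval x.ofLp p * w (‖x‖ ^ 2) := (hHw w _ hw hw0).symm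
    _ ≤ ∫ x : EuclideanSpace ℝ (Fin k), (F (c + x) * w (‖x‖ ^ 2) + 2 * ε * w (‖x‖ ^ 2)) := by
        refine integral_mono (integrable_mul_radial hw hw0 (continuous_eval_ofLp _))
          ((integrable_mul_radial hw hw0 hFc).add
            (integrable_mul_radial hw hw0 continuous_const)) fun x => ?_
        by_cases hx : ‖x‖ ≤ r
        · have := mul_le_mul_of_nonneg_right (hpu x hx) (hwn (‖x‖ ^ 2))
          simpa only [add_mul] using this
        · simp [hout x hx]
    _ = (∫ x : EuclideanSpace ℝ (Fin k), F (c + x) * w (‖x‖ ^ 2)) + 2 * ε * I := by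
        rw [integral_add (integrable_mul_radial hw hw0 hFc)
          (integrable_mul_radial hw hw0 continuous_const), integral_const_mul]
    _ ≤ _ := by linarith

/-! ### Tubes around Lipschitz curves -/

theorem norm_sq_headPart_add_norm_sq_tailPart {p q k : ℕ} (h : p + q = k)
    (x : EuclideanSpace ℝ (Fin k)) : ‖headPart h x‖ ^ 2 + ‖tailPart h x‖ ^ 2 = ‖x‖ ^ 2 := by
  subst h
  rw [EuclideanSpace.real_norm_sq_eq, EuclideanSpace.real_norm_sq_eq,
    EuclideanSpace.real_norm_sq_eq, Fin.sum_univ_add]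
  rfl

theorem norm_headPart_le {p q k : ℕ} (h : p + q = k) (x : EuclideanSpace ℝ (Fin k)) :
    ‖headPart h x‖ ≤ ‖x‖ := by
  refine le_of_sq_le_sq ?_ (norm_nonneg _)
  have := norm_sq_headPart_add_norm_sq_tailPart h x
  nlinarith [sq_nonneg ‖tailPart h x‖]

theorem norm_tailPart_le {p q k : ℕ} (h : p + q = k) (x : EuclideanSpace ℝ (Fin k)) :
    ‖tailPart h x‖ ≤ ‖x‖ := by
  refine le_of_sq_le_sq ?_ (norm_nonneg _)
  have := norm_sq_headPart_add_norm_sq_tailPart h x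
  nlinarith [sq_nonneg ‖headPart h x‖]

theorem norm_le_norm_headPart_add_norm_tailPart {p q k : ℕ} (h : p + q = k)
    (x : EuclideanSpace ℝ (Fin k)) : ‖x‖ ≤ ‖headPart h x‖ + ‖tailPart h x‖ := by
  refine le_of_sq_le_sq ?_ (by positivity)
  have := norm_sq_headPart_add_norm_sq_tailPart h x
  nlinarith [norm_nonneg (headPart h x), norm_nonneg (tailPart h x)]

/-- Near each of its points, a Lipschitz curve has a coordinate that controls distances. -/
theorem IsLipschitzCurve.exists_coordinate {k : ℕ} {Γ : Set (EuclideanSpace ℝ (Fin k))}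
    (hΓ : IsLipschitzCurve Γ) :
    ∃ L r₀ : ℝ, 0 < L ∧ 0 < r₀ ∧ ∀ a ∈ Γ, ∃ T : EuclideanSpace ℝ (Fin k) → ℝ,
      (∀ b, |T b| ≤ dist b a) ∧
      ∀ b ∈ Γ, ∀ b' ∈ Γ, dist b a < r₀ → dist b' a < r₀ → dist b b' ≤ L * |T b - T b'| := by
  obtain ⟨q, h, -, L, R, hL, hR, hloc⟩ := hΓ
  have hL' : (0 : ℝ) < L := by exact_mod_cast hL
  -- Points this close to `a` fall into the cylinder, hence on the graph; there the tail difference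
  -- is at most `L` times the head difference.
  refine ⟨1 + L, min R (3 * L * R), by positivity, by positivity, fun a ha => ?_⟩
  obtain ⟨φ, U, hφ, hU⟩ := hloc a ha
  have hT1 : ∀ z : EuclideanSpace ℝ (Fin 1), |z.ofLp 0| = ‖z‖ := by
    intro z
    rw [EuclideanSpace.norm_eq]
    simp [Real.sqrt_sq_eq_abs]
  have hgraph : ∀ b ∈ Γ, dist b a < min R (3 * L * R) →
      U (b - a) ∈ graphOver h φ (Metric.ball 0 R) := by
    intro b hb hba
    rw [← hU]
    have hn : ‖U (b - a)‖ = dist b a := by rw [LinearIsometryEquiv.norm_map, dist_eq_norm]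
    have h0 : headPart h (0 : EuclideanSpace ℝ (Fin k)) = 0 := by ext; simp [headPart]
    have h0' : tailPart h (0 : EuclideanSpace ℝ (Fin k)) = 0 := by ext; simp [tailPart]
    refine ⟨⟨?_, ?_⟩, b, hb, rfl⟩
    · rw [h0, mem_ball_zero_iff]
      exact (norm_headPart_le h _).trans_lt (hn ▸ hba.trans_le (min_le_left _ _))
    · rw [h0', mem_ball_zero_iff]
      exact (norm_tailPart_le h _).trans_lt (hn ▸ hba.trans_le (min_le_right _ _))
  refine ⟨fun b => (headPart h (U (b - a))).ofLp 0, fun b => ?_, fun b hb b' hb' hba hba' => ?_⟩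
  · rw [hT1]
    refine (norm_headPart_le h _).trans ?_
    rw [LinearIsometryEquiv.norm_map, dist_eq_norm]
  · obtain ⟨hz, hzt⟩ := hgraph b hb hba
    obtain ⟨hz', hzt'⟩ := hgraph b' hb' hba'
    have hd : dist b b' = ‖U (b - a) - U (b' - a)‖ := by
      rw [← map_sub, LinearIsometryEquiv.norm_map, dist_eq_norm]; congr 1; abel
    have e1 : headPart h (U (b - a) - U (b' - a))
        = headPart h (U (b - a)) - headPart h (U (b' - a)) := by ext; simp [headPart]
    have e2 : tailPart h (U (b - a) - U (b' - a))
        = tailPart h (U (b - a)) - tailPart h (U (b' - a)) := by ext; simp [tailPart]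
    have e3 : |(headPart h (U (b - a))).ofLp 0 - (headPart h (U (b' - a))).ofLp 0|
        = ‖headPart h (U (b - a)) - headPart h (U (b' - a))‖ := by
      rw [← hT1]; simp
    rw [hd, e3]
    refine (norm_le_norm_headPart_add_norm_tailPart h _).trans ?_
    rw [e1, e2, hzt, hzt']
    have := hφ.dist_le_mul _ hz _ hz'
    rw [dist_eq_norm, dist_eq_norm] at this
    linarith

/-- The part of a small ball within distance `2 r / 2 ^ j` of a Lipschitz curve has volume
`O(r ^ k 2 ^ (-j (k - 1)))`. -/
theorem IsLipschitzCurve.exists_volume_tube_le {k : ℕ} {Γ : Set (EuclideanSpace ℝ (Fin k))}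
    (hΓ : IsLipschitzCurve Γ) :
    ∃ C r₀ : ℝ, 0 ≤ C ∧ 0 < r₀ ∧ ∀ (x : EuclideanSpace ℝ (Fin k)) (r : ℝ) (j : ℕ), 0 < r → r < r₀ →
      volume.real {y ∈ Metric.closedBall x r | ∃ a ∈ Γ, dist y a < 2 * r / 2 ^ j}
        ≤ C * (2 ^ j * (r / 2 ^ j) ^ k) := by
  obtain ⟨L, r₀, hL, hr₀, hcoord⟩ := hΓ.exists_coordinate
  set V := volume.real (Metric.ball (0 : EuclideanSpace ℝ (Fin k)) 1) with hV
  have hV0 : 0 ≤ V := measureReal_nonneg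
  -- On the relevant part of `Γ` the coordinate lies in `[-6r, 6r]`, which is `6 * 2 ^ j` intervals
  -- of length `s`; with the end point at most `7 * 2 ^ j` balls of radius `(1 + L) s` are needed.
  -- The bound `r₀ / 7` keeps `6r < r₀`.
  refine ⟨7 * (2 * (1 + L)) ^ k * V, r₀ / 7, by positivity, by positivity, fun x r j hr hrr => ?_⟩
  set s := 2 * r / 2 ^ j with hs
  have hj1 : (1 : ℝ) ≤ 2 ^ j := one_le_pow₀ (by norm_num)
  have hs0 : 0 < s := by positivity
  have hs2 : s ≤ 2 * r := div_le_self (by positivity) hj1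
  by_cases hne : ∃ a ∈ Γ, dist a x ≤ 3 * r
  swap
  · have : {y ∈ Metric.closedBall x r | ∃ a ∈ Γ, dist y a < s} = ∅ := by
      refine Set.eq_empty_of_forall_notMem fun y ⟨hy, a, ha, hya⟩ => hne ⟨a, ha, ?_⟩
      have := dist_triangle a y x
      rw [dist_comm a y] at this
      have := Metric.mem_closedBall.1 hy
      linarith
    rw [this, measureReal_empty]
    positivity
  obtain ⟨a, ha, hax⟩ := hne
  obtain ⟨T, hT, hTd⟩ := hcoord a ha
  -- Curve points are sorted by the interval of length `s` containing their coordinate; two in the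
  -- same class are within `L s`, so one representative per class suffices.
  let P : ℕ → EuclideanSpace ℝ (Fin k) → Prop := fun n b =>
    b ∈ Γ ∧ dist b x ≤ 3 * r ∧ ⌊(T b + 6 * r) / s⌋₊ = n
  have hclose : ∀ b, dist b x ≤ 3 * r → dist b a ≤ 6 * r := fun b hb => by
    have := dist_triangle_right b a x
    linarith
  have hTb : ∀ b, dist b x ≤ 3 * r → 0 ≤ (T b + 6 * r) / s ∧ (T b + 6 * r) / s ≤ 6 * 2 ^ j := by
    intro b hb
    have := abs_le.1 ((hT b).trans (hclose b hb))
    refine ⟨div_nonneg (by linarith) hs0.le, ?_⟩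
    rw [div_le_iff₀ hs0, hs]
    have : 6 * 2 ^ j * (2 * r / 2 ^ j) = 12 * r := by field_simp; ring
    linarith
  have hPP : ∀ n b b', P n b → P n b' → dist b b' ≤ L * s := by
    rintro n b b' ⟨hb, hbx, hbn⟩ ⟨hb', hbx', hbn'⟩
    refine (hTd b hb b' hb' (by linarith [hclose b hbx]) (by linarith [hclose b' hbx'])).trans ?_
    refine mul_le_mul_of_nonneg_left ?_ hL.le
    have h1 := Nat.floor_le (hTb b hbx).1
    have h2 := Nat.lt_floor_add_one ((T b + 6 * r) / s)
    have h3 := Nat.floor_le (hTb b' hbx').1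
    have h4 := Nat.lt_floor_add_one ((T b' + 6 * r) / s)
    rw [hbn] at h1 h2
    rw [hbn'] at h3 h4
    rw [le_div_iff₀ hs0] at h1 h3
    rw [div_lt_iff₀ hs0] at h2 h4
    rw [abs_le]
    constructor <;> linarith
  choose! b hb using fun n (hn : ∃ b, P n b) => hn
  have hcover : {y ∈ Metric.closedBall x r | ∃ a ∈ Γ, dist y a < s}
      ⊆ ⋃ n ∈ Finset.range (6 * 2 ^ j + 1), Metric.closedBall (b n) ((1 + L) * s) := by
    rintro y ⟨hy, z, hz, hyz⟩
    have hzx : dist z x ≤ 3 * r := by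
      have := dist_triangle z y x
      rw [dist_comm z y] at this
      have := Metric.mem_closedBall.1 hy
      linarith
    have hPz : P ⌊(T z + 6 * r) / s⌋₊ z := ⟨hz, hzx, rfl⟩
    simp only [Set.mem_iUnion, Finset.mem_range]
    refine ⟨⌊(T z + 6 * r) / s⌋₊, ?_, ?_⟩
    · rw [Nat.lt_succ_iff]
      refine Nat.floor_le_of_le ?_
      push_cast
      exact (hTb z hzx).2
    · have := hPP _ _ _ hPz (hb _ ⟨z, hPz⟩)
      have h3 := dist_triangle y z (b ⌊(T z + 6 * r) / s⌋₊)
      rw [Metric.mem_closedBall]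
      linarith
  have hfin : volume (⋃ n ∈ Finset.range (6 * 2 ^ j + 1), Metric.closedBall (b n) ((1 + L) * s))
      ≠ ⊤ := by
    refine ((measure_biUnion_lt_top (Finset.finite_toSet _) fun n _ => ?_)).ne
    exact measure_closedBall_lt_top
  calc volume.real {y ∈ Metric.closedBall x r | ∃ a ∈ Γ, dist y a < s}
      ≤ volume.real (⋃ n ∈ Finset.range (6 * 2 ^ j + 1), Metric.closedBall (b n) ((1 + L) * s)) :=
        measureReal_mono hcover hfin
    _ ≤ ∑ n ∈ Finset.range (6 * 2 ^ j + 1), volume.real (Metric.closedBall (b n) ((1 + L) * s)) :=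
        measureReal_biUnion_finset_le _ _
    _ = (6 * 2 ^ j + 1) * (((1 + L) * s) ^ k * V) := by
        have : ∀ n, volume.real (Metric.closedBall (b n) ((1 + L) * s)) = ((1 + L) * s) ^ k * V := by
          intro n
          rw [Measure.addHaar_real_closedBall _ _ (by positivity), finrank_euclideanSpace_fin]
        simp [this]
    _ ≤ (7 * 2 ^ j) * (((1 + L) * s) ^ k * V) := by
        refine mul_le_mul_of_nonneg_right (by linarith) (by positivity)
    _ = _ := by
        have : (1 + L) * s = (2 * (1 + L)) * (r / 2 ^ j) := by rw [hs]; ring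
        rw [this, mul_pow _ (r / 2 ^ j)]
        ring

/-! ### The profile of the fundamental solution -/

theorem fundProfile_two (t : ℝ) : fundProfile 2 t = Real.log (1 / t) := by simp [fundProfile]

theorem fundProfile_add_three (n : ℕ) (t : ℝ) : fundProfile (n + 3) t = (t ^ (n + 1))⁻¹ := by
  have : (2 : ℤ) - ((n + 3 : ℕ) : ℤ) = -((n + 1 : ℕ) : ℤ) := by push_cast; ring
  rw [fundProfile, if_neg (by omega), this, zpow_neg, zpow_natCast]

theorem fundProfile_antitoneOn {k : ℕ} (hk : 2 ≤ k) :
    AntitoneOn (fundProfile k) (Set.Ioi 0) := by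
  intro s hs t _ hst
  have hs' : 0 < s := hs
  have ht' : 0 < t := hs'.trans_le hst
  rcases hk.eq_or_lt with rfl | hk
  · simp only [fundProfile_two]
    exact Real.log_le_log (by positivity) (one_div_le_one_div_of_le hs' hst)
  · obtain ⟨n, rfl⟩ := Nat.exists_eq_add_of_le' hk
    simp only [fundProfile_add_three]
    gcongr

theorem tendsto_fundProfile_zero {k : ℕ} (hk : 2 ≤ k) :
    Filter.Tendsto (fundProfile k) (nhdsWithin 0 (Set.Ioi 0)) Filter.atTop := by
  rcases hk.eq_or_lt with rfl | hk
  · have : fundProfile 2 = fun t => -Real.log t := by funext t; simp [fundProfile_two]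
    rw [this]
    exact Filter.tendsto_neg_atBot_atTop.comp Real.tendsto_log_nhdsGT_zero
  · obtain ⟨n, rfl⟩ := Nat.exists_eq_add_of_le' hk
    have : fundProfile (n + 3) = fun t => (t⁻¹) ^ (n + 1) := by
      funext t; simp [fundProfile_add_three]
    rw [this]
    exact (Filter.tendsto_pow_atTop (by omega)).comp tendsto_inv_nhdsGT_zero

/-- The increment over one dyadic step; `t ^ 2 / t ^ k` stands for `t^(2-k)` and covers `k = 2` as
well. -/
theorem fundProfile_half_sub_le {k : ℕ} (hk : 2 ≤ k) {t : ℝ} (ht : 0 < t) :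
    fundProfile k (t / 2) - fundProfile k t ≤ 2 ^ k * (t ^ 2 / t ^ k) := by
  rcases hk.eq_or_lt with rfl | hk
  · have h1 : t ^ 2 / t ^ 2 = 1 := div_self (by positivity)
    rw [fundProfile_two, fundProfile_two, h1, one_div, one_div, Real.log_inv, Real.log_inv,
      Real.log_div ht.ne' (by norm_num)]
    have := Real.log_two_lt_d9
    norm_num
    linarith
  · obtain ⟨n, rfl⟩ := Nat.exists_eq_add_of_le' hk
    have h1 : t ^ 2 / t ^ (n + 3) = (t ^ (n + 1))⁻¹ := by
      field_simp; ring
    have h2 : ((t / 2) ^ (n + 1))⁻¹ = 2 ^ (n + 1) * (t ^ (n + 1))⁻¹ := by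
      rw [div_pow, inv_div]; rfl
    rw [fundProfile_add_three, fundProfile_add_three, h1, h2]
    have h3 : (2 : ℝ) ^ (n + 1) ≤ 2 ^ (n + 2 + 1) := pow_le_pow_right₀ (by norm_num) (by omega)
    have h4 : 0 ≤ (t ^ (n + 1))⁻¹ := by positivity
    nlinarith

/-- Shrinking `t` by `e^(-C)` adds exactly `C` if `k = 2`, and multiplies by `e^(C(k-2)) ≥ 1 + C` if
`k > 2`. -/
theorem fundProfile_add_le {k : ℕ} (hk : 2 ≤ k) {C t : ℝ} (hC : 0 ≤ C) (ht : 0 < t) :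
    fundProfile k t + C * (t ^ 2 / t ^ k) ≤ fundProfile k (Real.exp (-C) * t) := by
  rcases hk.eq_or_lt with rfl | hk
  · have h1 : t ^ 2 / t ^ 2 = 1 := div_self (by positivity)
    rw [fundProfile_two, fundProfile_two, h1, one_div, one_div, Real.log_inv, Real.log_inv,
      Real.log_mul (Real.exp_pos _).ne' ht.ne', Real.log_exp]
    linarith
  · obtain ⟨n, rfl⟩ := Nat.exists_eq_add_of_le' hk
    have h1 : t ^ 2 / t ^ (n + 3) = (t ^ (n + 1))⁻¹ := by
      field_simp; ring
    have h2 : ((Real.exp (-C) * t) ^ (n + 1))⁻¹ = Real.exp C ^ (n + 1) * (t ^ (n + 1))⁻¹ := by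
      rw [mul_pow, mul_inv, Real.exp_neg, inv_pow, inv_inv]
    rw [fundProfile_add_three, fundProfile_add_three, h1, h2]
    have h3 : C + 1 ≤ Real.exp C ^ (n + 1) :=
      (Real.add_one_le_exp C).trans (le_self_pow₀ (Real.one_le_exp hC) (by omega))
    have h4 : 0 ≤ (t ^ (n + 1))⁻¹ := by positivity
    nlinarith

/-! ### Dyadic majorants and their means over balls -/

/-- A continuous function of `d` dominating `fundProfile k (max d (r / 2 ^ J))`. -/
noncomputable def profileMajorant (k : ℕ) (r : ℝ) (J : ℕ) (d : ℝ) : ℝ :=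
  fundProfile k r + ∑ j ∈ Finset.range J,
    (fundProfile k (r / 2 ^ j / 2) - fundProfile k (r / 2 ^ j)) *
      max 0 (min 1 (2 - 2 ^ j * d / r))

theorem continuous_profileMajorant (k : ℕ) (r : ℝ) (J : ℕ) :
    Continuous (profileMajorant k r J) := by
  unfold profileMajorant
  fun_prop

theorem fundProfile_le_half {k : ℕ} (hk : 2 ≤ k) {t : ℝ} (ht : 0 < t) :
    fundProfile k t ≤ fundProfile k (t / 2) :=
  fundProfile_antitoneOn hk (Set.mem_Ioi.2 (half_pos ht)) (Set.mem_Ioi.2 ht) (by linarith)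

/-- The `j`-th cutoff is 1 for `d ≤ r/2^j` and 0 for `d ≥ 2r/2^j`. Here all are 1, and the
increments telescope. -/
theorem profileMajorant_of_le {k : ℕ} {r : ℝ} (hr : 0 < r) {J : ℕ} {d : ℝ}
    (hd : d ≤ r / 2 ^ J) : profileMajorant k r J d = fundProfile k (r / 2 ^ J) := by
  have hone : ∀ j ∈ Finset.range J, max 0 (min 1 (2 - 2 ^ j * d / r)) = 1 := by
    intro j hj
    have h1 : (2 : ℝ) ^ j ≤ 2 ^ J :=
      pow_le_pow_right₀ (by norm_num) (Finset.mem_range.1 hj).le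
    have h2 : d ≤ r / 2 ^ j := hd.trans (by gcongr)
    rw [le_div_iff₀ (by positivity)] at h2
    have h3 : 2 ^ j * d / r ≤ 1 := by rw [div_le_one hr]; linarith
    rw [min_eq_left (by linarith), max_eq_right (by norm_num)]
  unfold profileMajorant
  rw [Finset.sum_congr rfl fun j hj => by rw [hone j hj, mul_one]]
  have := Finset.sum_range_sub (fun j => fundProfile k (r / 2 ^ j)) J
  simp only [pow_succ, ← div_div] at this
  rw [this]
  simp

theorem le_profileMajorant {k : ℕ} (hk : 2 ≤ k) {r : ℝ} (hr : 0 < r) (J : ℕ) {d : ℝ}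
    (hd : r / 2 ^ J ≤ d) : fundProfile k d ≤ profileMajorant k r J d := by
  induction J with
  | zero =>
    simp only [pow_zero, div_one] at hd
    simpa [profileMajorant] using fundProfile_antitoneOn hk hr (hr.trans_le hd) hd
  | succ J ih =>
    have hsucc : profileMajorant k r (J + 1) d = profileMajorant k r J d +
        (fundProfile k (r / 2 ^ J / 2) - fundProfile k (r / 2 ^ J)) *
          max 0 (min 1 (2 - 2 ^ J * d / r)) := by
      unfold profileMajorant
      rw [Finset.sum_range_succ]; ring
    have hJ : 0 < r / 2 ^ J := by positivity
    by_cases h : r / 2 ^ J ≤ d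
    · rw [hsucc]
      have := mul_nonneg (sub_nonneg.2 (fundProfile_le_half hk hJ))
        (le_max_left 0 (min 1 (2 - 2 ^ J * d / r)))
      linarith [ih h]
    · push Not at h
      have h1 : max 0 (min 1 (2 - 2 ^ J * d / r)) = 1 := by
        rw [lt_div_iff₀ (by positivity)] at h
        have h3 : 2 ^ J * d / r ≤ 1 := by rw [div_le_one hr]; linarith
        rw [min_eq_left (by linarith), max_eq_right (by norm_num)]
      rw [hsucc, profileMajorant_of_le hr h.le, h1, mul_one, add_sub_cancel]
      rw [pow_succ, ← div_div] at hd
      exact fundProfile_antitoneOn hk (half_pos hJ) ((half_pos hJ).trans_le hd) hd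

/-- The radial weight used for averaging over balls of radius `r`. -/
noncomputable def ballWeight (r s : ℝ) : ℝ := max (r ^ 2 - s) 0

theorem continuous_ballWeight (r : ℝ) : Continuous (ballWeight r) := by
  unfold ballWeight; fun_prop

theorem ballWeight_eq_zero {r s : ℝ} (h : r ^ 2 ≤ s) : ballWeight r s = 0 :=
  max_eq_right (by linarith)

theorem ballWeight_nonneg (r s : ℝ) : 0 ≤ ballWeight r s := le_max_right _ _

theorem le_integral_ballWeight (k : ℕ) {r : ℝ} (hr : 0 < r) :
    r ^ 2 / 2 * ((r / 2) ^ k * volume.real (Metric.ball (0 : EuclideanSpace ℝ (Fin k)) 1))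
      ≤ ∫ x : EuclideanSpace ℝ (Fin k), ballWeight r (‖x‖ ^ 2) := by
  have hint : Integrable fun x : EuclideanSpace ℝ (Fin k) => ballWeight r (‖x‖ ^ 2) := by
    simpa using integrable_mul_radial (continuous_ballWeight r) (fun s => ballWeight_eq_zero)
      (continuous_const (y := (1 : ℝ)) (X := EuclideanSpace ℝ (Fin k)))
  have hv : volume.real (Metric.closedBall (0 : EuclideanSpace ℝ (Fin k)) (r / 2))
      = (r / 2) ^ k * volume.real (Metric.ball (0 : EuclideanSpace ℝ (Fin k)) 1) := by
    rw [Measure.addHaar_real_closedBall _ _ (by positivity), finrank_euclideanSpace_fin]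
  calc r ^ 2 / 2 * ((r / 2) ^ k * volume.real (Metric.ball (0 : EuclideanSpace ℝ (Fin k)) 1))
      = ∫ x : EuclideanSpace ℝ (Fin k),
          (Metric.closedBall (0 : EuclideanSpace ℝ (Fin k)) (r / 2)).indicator
            (fun _ => r ^ 2 / 2) x := by
        rw [integral_indicator_const _ measurableSet_closedBall, hv, smul_eq_mul, mul_comm]
    _ ≤ _ := by
        refine integral_mono ((integrable_indicator_iff measurableSet_closedBall).2
          (integrableOn_const measure_closedBall_lt_top.ne)) hint fun x => ?_
        by_cases hx : x ∈ Metric.closedBall (0 : EuclideanSpace ℝ (Fin k)) (r / 2)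
        · have hx' : ‖x‖ ≤ r / 2 := by simpa using hx
          rw [Set.indicator_of_mem hx]
          refine le_trans ?_ (le_max_left _ _)
          nlinarith [norm_nonneg x]
        · rw [Set.indicator_of_notMem hx]
          exact ballWeight_nonneg _ _

/-- The cutoff is at most 1 and vanishes outside the tube; the weight is at most `r²` and vanishes
outside the ball. -/
theorem integral_tube_mul_ballWeight_le {k : ℕ} {r : ℝ} (hr : 0 < r) (j : ℕ)
    {d : EuclideanSpace ℝ (Fin k) → ℝ} (hd : Continuous d) (c : EuclideanSpace ℝ (Fin k)) :
    ∫ x : EuclideanSpace ℝ (Fin k),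
        max 0 (min 1 (2 - 2 ^ j * d (c + x) / r)) * ballWeight r (‖x‖ ^ 2)
      ≤ r ^ 2 * volume.real {y ∈ Metric.closedBall c r | d y < 2 * r / 2 ^ j} := by
  set S := {y ∈ Metric.closedBall c r | d y < 2 * r / 2 ^ j} with hS
  have hSm : MeasurableSet S :=
    measurableSet_closedBall.inter (measurableSet_lt hd.measurable measurable_const)
  have hSfin : volume S ≠ ⊤ :=
    ((measure_mono fun y hy => hy.1).trans_lt (measure_closedBall_lt_top (x := c) (r := r))).ne
  have hdc : Continuous fun x => max 0 (min 1 (2 - 2 ^ j * d (c + x) / r)) := by fun_prop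
  have hi : Integrable (S.indicator fun _ => r ^ 2) :=
    (integrable_indicator_iff hSm).2 (integrableOn_const hSfin)
  calc _ ≤ ∫ x : EuclideanSpace ℝ (Fin k), S.indicator (fun _ => r ^ 2) (c + x) := by
        refine integral_mono (integrable_mul_radial (continuous_ballWeight r)
          (fun s => ballWeight_eq_zero) hdc) (hi.comp_add_left c) fun x => ?_
        have hw2 : ballWeight r (‖x‖ ^ 2) ≤ r ^ 2 :=
          max_le (by nlinarith [sq_nonneg ‖x‖]) (sq_nonneg r)
        have hw0 := ballWeight_nonneg r (‖x‖ ^ 2)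
        beta_reduce
        by_cases hx : c + x ∈ S
        · rw [Set.indicator_of_mem hx]
          have h1 : max 0 (min 1 (2 - 2 ^ j * d (c + x) / r)) ≤ 1 :=
            max_le zero_le_one (min_le_left _ _)
          have h0 : 0 ≤ max 0 (min 1 (2 - 2 ^ j * d (c + x) / r)) := le_max_left _ _
          nlinarith
        · rw [Set.indicator_of_notMem hx]
          refine le_of_eq (mul_eq_zero.2 ?_)
          by_cases hxr : ‖x‖ ≤ r
          · left
            have hdx : 2 * r / 2 ^ j ≤ d (c + x) := by
              by_contra! hlt
              exact hx ⟨by simpa [mem_closedBall_iff_norm] using hxr, hlt⟩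
            rw [div_le_iff₀ (by positivity)] at hdx
            have : 2 ≤ 2 ^ j * d (c + x) / r := by rw [le_div_iff₀ hr]; linarith
            exact max_eq_left ((min_le_right _ _).trans (by linarith))
          · right
            exact ballWeight_eq_zero (by nlinarith)
    _ = ∫ x : EuclideanSpace ℝ (Fin k), S.indicator (fun _ => r ^ 2) x :=
        integral_add_left_eq_self (fun x => S.indicator (fun _ => r ^ 2) x) c
    _ = _ := by rw [integral_indicator_const _ hSm, smul_eq_mul, mul_comm]

/-- The mean over a small ball of the majorants of `fundProfile k (dist y Γ)`, for a Lipschitz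
curve `Γ`, is at most the profile at a fixed multiple of the radius. -/
theorem IsLipschitzCurve.exists_weighted_mean_le {k : ℕ} (hk : 2 ≤ k)
    {Γ : Set (EuclideanSpace ℝ (Fin k))} (hΓ : IsLipschitzCurve Γ) :
    ∃ C r₀ : ℝ, 0 ≤ C ∧ 0 < r₀ ∧ ∀ (c : EuclideanSpace ℝ (Fin k)) (r : ℝ) (J : ℕ)
      (d : EuclideanSpace ℝ (Fin k) → ℝ), 0 < r → r < r₀ → Continuous d →
      (∀ y ∈ Metric.closedBall c r, ∀ s ≤ 2 * r, d y < s → ∃ a ∈ Γ, dist y a < s) →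
      ∫ x : EuclideanSpace ℝ (Fin k), profileMajorant k r J (d (c + x)) * ballWeight r (‖x‖ ^ 2)
        ≤ fundProfile k (Real.exp (-C) * r) *
          ∫ x : EuclideanSpace ℝ (Fin k), ballWeight r (‖x‖ ^ 2) := by
  obtain ⟨K, r₀, hK, hr₀, hvol⟩ := hΓ.exists_volume_tube_le
  set V := volume.real (Metric.ball (0 : EuclideanSpace ℝ (Fin k)) 1) with hV
  have hV0 : 0 < V := by
    rw [hV, measureReal_def]
    exact ENNReal.toReal_pos (Metric.measure_ball_pos _ _ one_pos).ne' measure_ball_lt_top.ne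
  -- The increments contribute at most `2^(k+1) K r^4`, and the weight has integral at least `V
  -- r^(k+2) / 2^(k+1)`; `C r^(2-k)` bounds the quotient.
  set C := 2 ^ (k + 1) * K * (2 ^ (k + 1) / V) with hC
  refine ⟨C, r₀, by positivity, hr₀, fun c r J d hr hrr hd hdist => ?_⟩
  set I := ∫ x : EuclideanSpace ℝ (Fin k), ballWeight r (‖x‖ ^ 2) with hI
  have hIl := le_integral_ballWeight k hr
  have hI0 : 0 ≤ I := integral_nonneg fun x => ballWeight_nonneg _ _
  -- The powers `t^(2-k)` and `t^k` combine to `2^j t² = r² / 2^j`: the geometric decay comes from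
  -- `Γ` being one-dimensional.
  have hterm : ∀ j, (fundProfile k (r / 2 ^ j / 2) - fundProfile k (r / 2 ^ j)) *
      ∫ x : EuclideanSpace ℝ (Fin k),
        max 0 (min 1 (2 - 2 ^ j * d (c + x) / r)) * ballWeight r (‖x‖ ^ 2)
      ≤ 2 ^ k * K * r ^ 4 * (1 / 2) ^ j := by
    intro j
    set t := r / 2 ^ j with ht
    have ht0 : 0 < t := by positivity
    have h1 := fundProfile_half_sub_le hk ht0
    have h2 := integral_tube_mul_ballWeight_le hr j hd c
    have h3 : volume.real {y ∈ Metric.closedBall c r | d y < 2 * r / 2 ^ j}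
        ≤ K * (2 ^ j * t ^ k) := by
      refine (measureReal_mono ?_ ?_).trans (hvol c r j hr hrr)
      · rintro y ⟨hy, hyd⟩
        exact ⟨hy, hdist y hy _ (div_le_self (by positivity) (one_le_pow₀ (by norm_num))) hyd⟩
      · exact ((measure_mono fun y hy => hy.1).trans_lt
          (measure_closedBall_lt_top (x := c) (r := r))).ne
    have h4 : 0 ≤ ∫ x : EuclideanSpace ℝ (Fin k),
        max 0 (min 1 (2 - 2 ^ j * d (c + x) / r)) * ballWeight r (‖x‖ ^ 2) :=
      integral_nonneg fun x => mul_nonneg (le_max_left _ _) (ballWeight_nonneg _ _)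
    calc _ ≤ 2 ^ k * (t ^ 2 / t ^ k) * (r ^ 2 * (K * (2 ^ j * t ^ k))) := by
          refine mul_le_mul h1 (h2.trans ?_) h4 (by positivity)
          exact mul_le_mul_of_nonneg_left h3 (sq_nonneg r)
      _ = 2 ^ k * K * r ^ 2 * (2 ^ j * t ^ 2) := by field_simp
      _ = 2 ^ k * K * r ^ 4 * (1 / 2) ^ j := by
          rw [ht, div_pow, one_div, inv_pow]
          field_simp
  have hcont : ∀ j : ℕ, Continuous fun x => max 0 (min 1 (2 - 2 ^ j * d (c + x) / r)) :=
    fun j => by fun_prop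
  have hsplit : ∫ x : EuclideanSpace ℝ (Fin k),
        profileMajorant k r J (d (c + x)) * ballWeight r (‖x‖ ^ 2)
      = fundProfile k r * I + ∑ j ∈ Finset.range J,
        (fundProfile k (r / 2 ^ j / 2) - fundProfile k (r / 2 ^ j)) *
      ∫ x : EuclideanSpace ℝ (Fin k),
        max 0 (min 1 (2 - 2 ^ j * d (c + x) / r)) * ballWeight r (‖x‖ ^ 2) := by
    simp only [profileMajorant, add_mul, Finset.sum_mul, mul_assoc]
    rw [integral_add, integral_const_mul, integral_finsetSum]
    · simp only [integral_const_mul]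
      rfl
    · exact fun j _ => (integrable_mul_radial (continuous_ballWeight r)
        (fun s => ballWeight_eq_zero) (hcont j)).const_mul _
    · exact integrable_mul_radial (continuous_ballWeight r) (fun s => ballWeight_eq_zero)
        continuous_const
    · exact integrable_finsetSum _ fun j _ => (integrable_mul_radial (continuous_ballWeight r)
        (fun s => ballWeight_eq_zero) (hcont j)).const_mul _
  have hgeom : ∑ j ∈ Finset.range J, ((1 : ℝ) / 2) ^ j ≤ 2 := by
    have := Summable.sum_le_tsum (Finset.range J) (fun j _ => by positivity)
      (summable_geometric_two)
    rwa [tsum_geometric_two] at this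
  calc _ ≤ fundProfile k r * I + ∑ j ∈ Finset.range J, 2 ^ k * K * r ^ 4 * (1 / 2) ^ j := by
        rw [hsplit]
        exact add_le_add le_rfl (Finset.sum_le_sum fun j _ => hterm j)
    _ ≤ fundProfile k r * I + 2 ^ k * K * r ^ 4 * 2 := by
        rw [← Finset.mul_sum]
        gcongr
    _ = fundProfile k r * I + C * (r ^ 2 / r ^ k) * (r ^ 2 / 2 * ((r / 2) ^ k * V)) := by
        rw [hC, div_pow]
        field_simp
        ring
    _ ≤ fundProfile k r * I + C * (r ^ 2 / r ^ k) * I := by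
        gcongr
    _ = (fundProfile k r + C * (r ^ 2 / r ^ k)) * I := by ring
    _ ≤ _ := mul_le_mul_of_nonneg_right (fundProfile_add_le hk (by positivity) hr) hI0

/-! ### Jensen's inequality and the local estimate -/

theorem ConcaveOn.exists_supergradient {f : ℝ → ℝ} {S : Set ℝ} (hf : ConcaveOn ℝ S f) {s₀ : ℝ}
    (hs₀ : s₀ ∈ interior S) : ∃ a : ℝ, ∀ s ∈ S, f s ≤ f s₀ + a * (s - s₀) := by
  have hc : ConvexOn ℝ S (-f) := hf.neg
  refine ⟨-derivWithin (-f) (Set.Ioi s₀) s₀, fun s hs => ?_⟩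
  rcases lt_trichotomy s s₀ with h | rfl | h
  · have h1 := (hc.slope_le_leftDeriv_of_mem_interior hs hs₀ h).trans
      (hc.leftDeriv_le_rightDeriv_of_mem_interior hs₀)
    rw [slope_def_field, div_le_iff₀ (sub_pos.2 h)] at h1
    simp only [Pi.neg_apply] at h1
    linarith
  · simp
  · have h1 := hc.rightDeriv_le_slope_of_mem_interior hs₀ hs h
    rw [slope_def_field, le_div_iff₀ (sub_pos.2 h)] at h1
    simp only [Pi.neg_apply] at h1
    linarith

/-- Around a point whose distance `4 r` to `B` is small, the ball of radius `r` avoids `B`, and a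
majorant `ψ (fundProfile k (dist y (A ∪ B)))` of `u` on it is averaged out to
`ψ (fundProfile k (exp (-C) r))`. -/
theorem IsSubharmonicOn.le_of_le_comp_fundProfile {k : ℕ} (hk : 2 ≤ k)
    {u : EuclideanSpace ℝ (Fin k) → EReal} {D : Set (EuclideanSpace ℝ (Fin k))}
    (hu : IsSubharmonicOn u D) {x : EuclideanSpace ℝ (Fin k)} {r : ℝ} (hr : 0 < r)
    (hball : Metric.closedBall x r ⊆ D) {β : ℝ} {ψ : ℝ → ℝ}
    (hψconc : ConcaveOn ℝ (Set.Ioi β) ψ) (hψlim : Filter.Tendsto ψ Filter.atTop Filter.atTop)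
    {d : EuclideanSpace ℝ (Fin k) → ℝ} (hd : Continuous d)
    (hud : ∀ y ∈ Metric.closedBall x r, 0 < d y →
      β < fundProfile k (d y) ∧ u y ≤ (ψ (fundProfile k (d y)) : ℝ))
    {s₀ : ℝ} (hs₀ : β < s₀)
    (hmean : ∀ J, ∫ y : EuclideanSpace ℝ (Fin k),
        profileMajorant k r J (d (x + y)) * ballWeight r (‖y‖ ^ 2)
      ≤ s₀ * ∫ y : EuclideanSpace ℝ (Fin k), ballWeight r (‖y‖ ^ 2)) :
    u x ≤ (ψ s₀ : ℝ) := by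
  have hxr : x ∈ Metric.closedBall x r := Metric.mem_closedBall_self hr.le
  obtain ⟨y₀, hy₀, hmax⟩ := (hu.2.1.mono hball).exists_isMaxOn ⟨x, hxr⟩ (isCompact_closedBall x r)
  -- The maximum bounds `u` also on the zero set of `d`. If it is `⊥`, `toReal` gives 0, still an
  -- upper bound.
  have hM : ∀ y ∈ Metric.closedBall x r, u y ≤ ((u y₀).toReal : EReal) := fun y hy =>
    (hmax hy).trans (EReal.le_coe_toReal (hu.1 y₀ (hball hy₀)).ne)
  obtain ⟨a, ha⟩ := hψconc.exists_supergradient (s₀ := s₀) (by rwa [interior_Ioi])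
  -- A slope `a ≤ 0` would bound `ψ` on `[s₀, ∞)`.
  have ha0 : 0 < a := by
    by_contra! h
    obtain ⟨s, hs1, hs2⟩ :=
      ((hψlim.eventually_gt_atTop (ψ s₀)).and (Filter.eventually_ge_atTop s₀)).exists
    have := ha s (hs₀.trans_le hs2)
    nlinarith
  have hlim : Filter.Tendsto (fun J : ℕ => fundProfile k (r / 2 ^ J)) Filter.atTop Filter.atTop := by
    refine (tendsto_fundProfile_zero hk).comp (tendsto_nhdsWithin_iff.2 ⟨?_, ?_⟩)
    · have := (tendsto_pow_atTop_nhds_zero_of_lt_one (r := (1 / 2 : ℝ)) (by norm_num)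
        (by norm_num)).const_mul r
      rw [mul_zero] at this
      refine this.congr fun J => ?_
      rw [one_div, inv_pow, div_eq_mul_inv]
    · exact Filter.Eventually.of_forall fun J => Set.mem_Ioi.2 (by positivity)
  -- `J` is so large that the supporting line at `fundProfile k (r / 2 ^ J)` exceeds the maximum of
  -- `u`. The line applied to the truncated profile then majorizes `u` on the whole ball, including
  -- where `d` vanishes.
  obtain ⟨J, hJ⟩ := (hlim.eventually_ge_atTop (((u y₀).toReal - ψ s₀) / a + s₀)).exists
  have hJ' : (u y₀).toReal ≤ ψ s₀ + a * (fundProfile k (r / 2 ^ J) - s₀) := by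
    rw [← le_sub_iff_add_le, div_le_iff₀ ha0] at hJ
    linarith
  have hmc : Continuous fun y => profileMajorant k r J (d y) :=
    (continuous_profileMajorant k r J).comp hd
  have hF : Continuous fun y => ψ s₀ + a * (profileMajorant k r J (d y) - s₀) := by fun_prop
  have huF : ∀ y ∈ Metric.closedBall x r,
      u y ≤ ((ψ s₀ + a * (profileMajorant k r J (d y) - s₀) : ℝ) : EReal) := by
    intro y hy
    rcases le_total (d y) (r / 2 ^ J) with h | h
    · rw [profileMajorant_of_le hr h]
      exact (hM y hy).trans (EReal.coe_le_coe_iff.2 hJ')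
    · obtain ⟨h1, h2⟩ := hud y hy (lt_of_lt_of_le (by positivity) h)
      refine h2.trans (EReal.coe_le_coe_iff.2 ((ha _ h1).trans ?_))
      have := le_profileMajorant hk hr J h
      gcongr
  set I := ∫ y : EuclideanSpace ℝ (Fin k), ballWeight r (‖y‖ ^ 2) with hI
  have hI0 : 0 < I := by
    refine lt_of_lt_of_le ?_ (le_integral_ballWeight k hr)
    have : 0 < volume.real (Metric.ball (0 : EuclideanSpace ℝ (Fin k)) 1) := by
      rw [measureReal_def]
      exact ENNReal.toReal_pos (Metric.measure_ball_pos _ _ one_pos).ne' measure_ball_lt_top.ne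
    positivity
  -- The negation excludes `u x = ⊥`, so `u x` is a real number.
  by_contra! hlt
  have hux : ((u x).toReal : EReal) = u x :=
    EReal.coe_toReal (hu.1 x (hball hxr)).ne (bot_le.trans_lt hlt).ne'
  have key := hu.weighted_mean_le (by omega) hball hF huF hux.le (continuous_ballWeight r)
    (fun s => ballWeight_eq_zero) (ballWeight_nonneg r) hr
  have hsplit : ∫ y : EuclideanSpace ℝ (Fin k),
        (ψ s₀ + a * (profileMajorant k r J (d (x + y)) - s₀)) * ballWeight r (‖y‖ ^ 2)
      = (ψ s₀ - a * s₀) * I + a * ∫ y : EuclideanSpace ℝ (Fin k),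
        profileMajorant k r J (d (x + y)) * ballWeight r (‖y‖ ^ 2) := by
    rw [← integral_const_mul, ← integral_const_mul, ← integral_add]
    · congr 1; funext y; ring
    · exact integrable_mul_radial (continuous_ballWeight r) (fun s => ballWeight_eq_zero)
        continuous_const
    · exact (integrable_mul_radial (continuous_ballWeight r) (fun s => ballWeight_eq_zero)
        (hmc.comp (by fun_prop : Continuous fun y => x + y))).const_mul a
  rw [hsplit] at key
  have h1 := mul_le_mul_of_nonneg_left (hmean J) ha0.le
  have h2 : (u x).toReal * I ≤ ψ s₀ * I := by linarith
  have h3 := le_of_mul_le_mul_right h2 hI0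
  rw [← hux] at hlt
  exact absurd (EReal.coe_lt_coe_iff.1 hlt) (not_lt.2 h3)

/-! ### The theorem -/

theorem theorem2p4 (k : ℕ) (hk : 2 ≤ k)
    (Ω A B Γ : Set (EuclideanSpace ℝ (Fin k)))
    (hΩo : IsOpen Ω) (hΩb : Bornology.IsBounded Ω)
    (hΓ : IsLipschitzCurve Γ) (hAc : IsClosed A) (hAΓ : A ⊆ Γ) (hAΩ : A ⊆ Ω)
    (hBc : IsClosed B) (hBΩ : (B ∩ Ω).Nonempty)
    (β : ℝ) (hβ : 0 < β) (ψ : ℝ → ℝ)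
    (hψpos : ∀ s ∈ Set.Ioi β, 0 < ψ s)
    (hψconc : ConcaveOn ℝ (Set.Ioi β) ψ)
    (hψmono : MonotoneOn ψ (Set.Ioi β))
    (hψlim : Filter.Tendsto ψ Filter.atTop Filter.atTop)
    (α : ℝ) (hα : 0 < α) (hαβ : ∀ t ∈ Set.Ioo 0 α, β < fundProfile k t)
    (g : ℝ → ℝ) (hg : ∀ t ∈ Set.Ioo 0 α, g t = ψ (fundProfile k t))
    (u : EuclideanSpace ℝ (Fin k) → EReal)
    (hu : IsSubharmonicOn u (Ω \ B))
    (hug : ∀ x ∈ Ω, 0 < Metric.infDist x (A ∪ B) → Metric.infDist x (A ∪ B) < α →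
      u x ≤ ((g (Metric.infDist x (A ∪ B)) : ℝ) : EReal)) :
    ∃ c₁ c₂ τ : ℝ, 0 < c₁ ∧ 0 < c₂ ∧ 0 < τ ∧ c₁ * τ ≤ α ∧ c₂ * τ ≤ α ∧
      ∀ x ∈ Ω, 0 < Metric.infDist x B → Metric.infDist x B < τ →
        u x ≤ ((2 * g (c₁ * Metric.infDist x B) - g (c₂ * Metric.infDist x B) : ℝ) : EReal) := by
  have hB : B.Nonempty := hBΩ.mono Set.inter_subset_left
  have hA : IsCompact A := by
    obtain ⟨q, h, hΓc, -⟩ := hΓ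
    exact hΓc.of_isClosed_subset hAc hAΓ
  obtain ⟨C, r₀, hC, hr₀, hmean⟩ := hΓ.exists_weighted_mean_le hk
  obtain ⟨ρ, hρ, hthick⟩ := hA.exists_thickening_subset_open hΩo hAΩ
  have hexp : Real.exp (-C) ≤ 1 := Real.exp_le_one_iff.2 (by linarith)
  have hexp0 := Real.exp_pos (-C)
  have hanti : ∀ s t, 0 < s → s ≤ t → t < α → g t ≤ g s := by
    intro s t hs hst ht
    have hs' : s ∈ Set.Ioo 0 α := ⟨hs, hst.trans_lt ht⟩
    have ht' : t ∈ Set.Ioo 0 α := ⟨hs.trans_le hst, ht⟩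
    rw [hg s hs', hg t ht']
    exact hψmono (hαβ t ht') (hαβ s hs') (fundProfile_antitoneOn hk hs'.1 ht'.1 hst)
  -- `α / 2` keeps the distances on the ball, at most `5δ/4`, below `α`; `r₀` admits the mean
  -- estimate; `ρ` keeps the ball, which is within `2r` of a point of `A`, inside `Ω`.
  set τ := min (α / 2) (min r₀ ρ) with hτ
  have hτα : τ ≤ α / 2 := min_le_left _ _
  have hτr : τ ≤ r₀ := (min_le_right _ _).trans (min_le_left _ _)
  have hτρ : τ ≤ ρ := (min_le_right _ _).trans (min_le_right _ _)
  have hτ0 : 0 < τ := by positivity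
  refine ⟨Real.exp (-C) / 4, 1, τ, by positivity, one_pos, hτ0, by nlinarith, by linarith,
    fun x hx hδ hδτ => ?_⟩
  obtain ⟨δ, hδdef⟩ : ∃ δ, δ = Metric.infDist x B := ⟨_, rfl⟩
  rw [← hδdef] at hδ hδτ ⊢
  have hc₁ : Real.exp (-C) / 4 * δ = Real.exp (-C) * (δ / 4) := by ring
  have hc₁pos : 0 < Real.exp (-C) * (δ / 4) := by positivity
  have hc₁le : Real.exp (-C) * (δ / 4) ≤ δ / 4 := by nlinarith
  rw [hc₁, one_mul]
  -- As `g` decreases, `g (c₁ δ) ≤ 2 g (c₁ δ) - g δ`; hence `c₂ = 1`.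
  suffices hmain : u x ≤ (g (Real.exp (-C) * (δ / 4)) : ℝ) by
    refine hmain.trans (EReal.coe_le_coe_iff.2 ?_)
    have := hanti (Real.exp (-C) * (δ / 4)) δ hc₁pos (by linarith) (by linarith)
    linarith
  have hdB : ∀ y, Metric.infDist y (A ∪ B) ≤ Metric.infDist y B := fun y =>
    Metric.infDist_le_infDist_of_subset Set.subset_union_right hB
  have hAB : (A ∪ B).Nonempty := hB.mono Set.subset_union_right
  have hBfar : ∀ b ∈ B, δ ≤ dist x b := fun b hb =>
    hδdef ▸ Metric.infDist_le_dist_of_mem hb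
  obtain ⟨r, hr⟩ : ∃ r, r = δ / 4 := ⟨_, rfl⟩
  rw [← hr] at hc₁pos hc₁le ⊢
  have hr0 : 0 < r := by linarith
  rcases le_or_gt r (Metric.infDist x (A ∪ B)) with hfar | hnear
  · have hlt : Metric.infDist x (A ∪ B) < α := (hdB x).trans_lt (by linarith)
    refine (hug x hx (hr0.trans_le hfar) hlt).trans (EReal.coe_le_coe_iff.2 ?_)
    exact hanti _ _ hc₁pos (hc₁le.trans hfar) hlt
  · obtain ⟨a, ha, hxa⟩ := (Metric.infDist_lt_iff hAB).1 hnear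
    have haA : a ∈ A := ha.resolve_right fun haB => by linarith [hBfar a haB]
    have hball : Metric.closedBall x r ⊆ Ω \ B := by
      intro y hy
      have hyx := Metric.mem_closedBall.1 hy
      refine ⟨hthick (Metric.mem_thickening_iff.2 ⟨a, haA, ?_⟩), fun hyB => ?_⟩
      · linarith [dist_triangle y x a]
      · have := hBfar y hyB
        rw [dist_comm] at this
        linarith
    rw [hg _ ⟨hc₁pos, by linarith⟩]
    refine hu.le_of_le_comp_fundProfile hk hr0 hball hψconc hψlim
      (d := fun y => Metric.infDist y (A ∪ B))
      (Metric.continuous_infDist_pt (A ∪ B)) (fun y hy hy0 => ?_)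
      (hαβ _ ⟨hc₁pos, by linarith⟩) fun J => ?_
    · have hyα : Metric.infDist y (A ∪ B) < α := by
        have h1 : Metric.infDist y B ≤ Metric.infDist x B + dist y x :=
          Metric.infDist_le_infDist_add_dist
        have := Metric.mem_closedBall.1 hy
        linarith [hdB y]
      refine ⟨hαβ _ ⟨hy0, hyα⟩, ?_⟩
      rw [← hg _ ⟨hy0, hyα⟩]
      exact hug y (hball hy).1 hy0 hyα
    -- `B` is at distance at least `4r` from `x`, so at least `3r` from `y`; points of `A ∪ B`
    -- within `2r` of `y` are on the curve.
    · refine hmean x r J (fun y => Metric.infDist y (A ∪ B)) hr0 (by linarith) (Metric.continuous_infDist_pt (A ∪ B))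
        fun y hy s hs hys => ?_
      obtain ⟨z, hz, hyz⟩ := (Metric.infDist_lt_iff hAB).1 hys
      refine ⟨z, hAΓ (hz.resolve_right fun hzB => ?_), hyz⟩
      have h1 := hBfar z hzB
      have h2 := Metric.mem_closedBall.1 hy
      have h3 := dist_triangle x y z
      rw [dist_comm x y] at h3
      linarith
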